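/- Consider the following 1-choice process with $n\ge 1$ bins, $n$ generators and arrival rate $\lambda$. At time $0$ all bins are empty. In every round, first every non-empty bin deletes one ball; then each of the $n$ generators generates a ball with probability $\lambda$, independently of each other and of the past, and every generated ball is placed into a bin chosen independently and uniformly at random. The load of a bin at step $t$ is the number of balls it contains after $t$ rounds. Let $\log$ be the natural logarithm and, for $\lambda<1$, put $$t(n,\lambda)=\frac{9\lambda\log n}{64(1-\lambda)^2}.$$ 1. There are an absolute constant $c>0$ and a sequence $\varepsilon_n\to 0$ such that for all $n\ge 1$, all $\lambda\in[1/2,1)$ and all integers $t\ge 0$ with $|t-t(n,\lambda)|<1$ (that is, $t(n,\lambda)$ rounded to an integer in either direction), with probability at least $1-\varepsilon_n$ some bin has load at least $$c\cdot\frac{1}{1-\lambda}\log n$$ at step $t$. In particular, for every function $\lambda=\lambda(n)\in[1/2,1)$ this happens with probability $1-o(1)$. 2. Consequently, the upper bound $O\bigl(\frac{1}{1-\lambda}\log\frac{n}{1-\lambda}\bigr)$ on the maximum load of the 1-choice process is asymptotically tight for $1/2\le\lambda\le 1-1/\mathrm{poly}(n)$: for every real polynomial $p$ there are a constant $c>0$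 and a sequence $\varepsilon_n\to0$ such that for all $n\ge 1$ with $p(n)>0$, all $\lambda$ with $1/2\le\lambda\le 1-1/p(n)$ and all integers $t\ge0$ with $|t-t(n,\lambda)|<1$, with probability at least $1-\varepsilon_n$ some bin has load at least $$c\cdot\frac{1}{1-\lambda}\log\frac{n}{1-\lambda}$$ at step $t$. -/

import Mathlib

open MeasureTheory ProbabilityTheory Filter Topology

noncomputable section

namespace OneChoice

/-- The randomness of the process with `n` bins and `n` generators. For the round number `t` and
the generator `j`, the first component of `ω (t, j)` says whether generator `j` generates a ball in
that round, and the second component is the bin to which such a ball is assigned. -/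
abbrev Outcome (n : ℕ) : Type := ℕ × Fin n → Bool × Fin n

/-- The law of the process randomness for arrival rate `lam`: independently over all rounds and all
generators, a ball is generated with probability `lam`, and independently of this the bin is
uniformly distributed over all `n` bins. -/
def law (n : ℕ) (lam : unitInterval) : Measure (Outcome n) :=
  Measure.infinitePi fun _ : ℕ × Fin n =>
    (bernoulliMeasure true false lam).prod (uniformOn (Set.univ : Set (Fin n)))

/-- The number of balls that bin `i` receives in the round numbered `t`. -/
def received {n : ℕ} (ω : Outcome n) (t : ℕ) (i : Fin n) : ℕ :=
  (Finset.univ.filter fun j : Fin n => ω (t, j) = (true, i)).card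

/-- The load of every bin of the 1-choice process after the given number of rounds. Initially all
bins are empty; in every round each non-empty bin first deletes one ball (the subtraction is that of
natural numbers, so empty bins stay empty) and then the newly generated balls are added. -/
def load {n : ℕ} (ω : Outcome n) : ℕ → Fin n → ℕ
  | 0 => fun _ => 0
  | t + 1 => fun i => (load ω t i - 1) + received ω t i

/-- The (real) number `9 λ log n / (64 (1 - λ)²)`. -/
def criticalTime (n : ℕ) (lam : ℝ) : ℝ :=
  9 * lam * Real.log n / (64 * (1 - lam) ^ 2)

end OneChoice

end

/-!
A bin deletes at most one ball per round, so after `t` rounds its load is at least the number of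
balls it has received minus `t`, and it suffices that some bin receives about
`t + log n / (128 (1 - λ))` balls although it expects only `λ t`. Raising the rate at which one
bin receives balls from `λ` to about `λ + 2 (1 - λ)` makes this likely for that bin, by a Chernoff
bound. Choose the favoured bin uniformly at random and let `Z` be the density of the resulting
mixture with respect to the law of the process. The total variation distance between the two laws
is at most `√Var Z`. As two different bins never receive the same ball, the densities belonging to
different bins are not positively correlated, so `Var Z` is at most `1 / n` times
`exp (4 (1 - λ) ^ 2 t / λ)`. At the critical time this is `O(n ^ (-7 / 16))`: the unmodified
process behaves like the mixture, and some bin overflows with high probability.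
-/

namespace OneChoice

lemma measureReal_le_setIntegral_add_sqrt_variance {Ω : Type*} {mΩ : MeasurableSpace Ω}
    {P : Measure Ω} [IsProbabilityMeasure P] {Z : Ω → ℝ} (hZ : MemLp Z 2 P) (hmean : P[Z] = 1)
    (B : Set Ω) :
    P.real B ≤ ∫ ω in B, Z ω ∂P + √Var[Z; P] := by
  have hdev : MemLp (fun ω => |Z ω - 1|) 2 P := (hZ.sub (memLp_const 1)).abs
  have hZi : Integrable Z P := hZ.integrable one_le_two
  have hdevi : Integrable (fun ω => |Z ω - 1|) P := hdev.integrable one_le_two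
  have mean_dev_le : ∫ ω, |Z ω - 1| ∂P ≤ √Var[Z; P] := by
    refine Real.le_sqrt_of_sq_le ?_
    have hvar : Var[Z; P] = ∫ ω, |Z ω - 1| ^ 2 ∂P := by
      simp_rw [variance_eq_integral hZ.aemeasurable, hmean, sq_abs]
    have := variance_nonneg (fun ω => |Z ω - 1|) P
    rw [variance_eq_sub hdev] at this
    rw [hvar]
    exact sub_nonneg.1 this
  calc P.real B = ∫ _ in B, (1 : ℝ) ∂P := by simp
    _ ≤ ∫ ω in B, (Z ω + |Z ω - 1|) ∂P :=
        integral_mono (integrable_const 1) (hZi.add hdevi).integrableOn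
          fun ω => by linarith [neg_le_abs (Z ω - 1)]
    _ = ∫ ω in B, Z ω ∂P + ∫ ω in B, |Z ω - 1| ∂P :=
        integral_add hZi.integrableOn hdevi.integrableOn
    _ ≤ ∫ ω in B, Z ω ∂P + √Var[Z; P] := by
        gcongr
        exact (setIntegral_le_integral hdevi (ae_of_all _ fun _ => abs_nonneg _)).trans
          mean_dev_le

section InfiniteProduct

variable {ι : Type*} {X : ι → Type*} {mX : ∀ i, MeasurableSpace (X i)}
  {μ : (i : ι) → Measure (X i)} [∀ i, IsProbabilityMeasure (μ i)] {𝕜 : Type*} [RCLike 𝕜]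
  (s : Finset ι) {f : (i : ι) → X i → 𝕜}

lemma integrable_finset_prod_infinitePi (hf : ∀ i ∈ s, Integrable (f i) (μ i)) :
    Integrable (fun x => ∏ i ∈ s, f i (x i)) (Measure.infinitePi μ) := by
  have hprod : Integrable (fun x : (i : s) → X i => ∏ i : s, f i (x i))
      ((Measure.infinitePi μ).map s.restrict) := by
    rw [Measure.infinitePi_map_restrict]
    exact Integrable.fintype_prod_dep fun i => hf i i.2
  have h := hprod.comp_measurable (Finset.measurable_restrict s)
  simpa only [Function.comp_def, Finset.restrict, Finset.prod_coe_sort s fun i => f i _] using h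

lemma integral_finset_prod_infinitePi (hf : ∀ i ∈ s, AEStronglyMeasurable (f i) (μ i)) :
    ∫ x, ∏ i ∈ s, f i (x i) ∂Measure.infinitePi μ = ∏ i ∈ s, ∫ y, f i y ∂μ i := by
  have hmeas : AEStronglyMeasurable (fun x : (i : s) → X i => ∏ i : s, f i (x i))
      (Measure.pi fun i : s => μ i) :=
    Finset.aestronglyMeasurable_fun_prod _ fun i _ =>
      (hf i i.2).comp_quasiMeasurePreserving (Measure.quasiMeasurePreserving_eval _ i)
  have h := integral_restrict_infinitePi (μ := μ) hmeas
  rw [integral_fintype_prod_eq_prod fun i : s => f i] at h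
  simpa only [Finset.restrict, Finset.prod_coe_sort s fun i => f i _,
    Finset.prod_coe_sort s fun i => ∫ y, f i y ∂μ i] using h

end InfiniteProduct

section Tilt

variable {X : Type*} [MeasurableSpace X] (μ : Measure X) {E F : Set X} {α : ℝ}

/-- The density with respect to `μ` of the law tilted towards the event `E` with strength `α`: under
the tilted law `E` has probability `p * (1 + α * (1 - p))`, where `p = μ.real E`. -/
noncomputable def tilt (E : Set X) (α : ℝ) (x : X) : ℝ := 1 + α * (E.indicator 1 x - μ.real E)

lemma tilt_nonneg (hα : 0 ≤ α) (hαE : α * μ.real E ≤ 1) (x : X) : 0 ≤ tilt μ E α x := by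
  have : 0 ≤ α * E.indicator 1 x := mul_nonneg hα (Set.indicator_nonneg (by simp) x)
  unfold tilt
  linarith

lemma exp_mul_indicator_mul_tilt (r : ℝ) (x : X) :
    Real.exp (-r * E.indicator 1 x) * tilt μ E α x =
      tilt μ E α x - (1 - Real.exp (-r)) * E.indicator (tilt μ E α) x := by
  by_cases hx : x ∈ E <;> simp [hx, sub_mul]

variable [IsProbabilityMeasure μ]

lemma memLp_tilt (hE : MeasurableSet E) (q : ENNReal) : MemLp (tilt μ E α) q μ := by
  have hind : MemLp (E.indicator (1 : X → ℝ)) q μ := (memLp_const 1).indicator hE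
  exact (memLp_const (1 : ℝ)).add ((hind.sub (memLp_const (μ.real E))).const_mul α)

lemma integrable_tilt (hE : MeasurableSet E) : Integrable (tilt μ E α) μ :=
  (memLp_tilt μ hE 1).integrable le_rfl

lemma setIntegral_tilt (hE : MeasurableSet E) (F : Set X) :
    ∫ x in F, tilt μ E α x ∂μ = μ.real F + α * (μ.real (E ∩ F) - μ.real E * μ.real F) := by
  have hind : Integrable (E.indicator (1 : X → ℝ)) (μ.restrict F) :=
    (integrable_const 1).indicator hE
  have hdev : Integrable (fun x => E.indicator (1 : X → ℝ) x - μ.real E) (μ.restrict F) :=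
    hind.sub (integrable_const _)
  unfold tilt
  rw [integral_add (integrable_const 1) (hdev.const_mul α), integral_const_mul,
    integral_sub hind (integrable_const _), integral_indicator_one hE]
  simp [measureReal_restrict_apply hE, mul_comm]

lemma integral_tilt (hE : MeasurableSet E) : ∫ x, tilt μ E α x ∂μ = 1 := by
  simpa using setIntegral_tilt μ (α := α) hE Set.univ

lemma integral_tilt_mul_tilt (hE : MeasurableSet E) (hF : MeasurableSet F) :
    ∫ x, tilt μ E α x * tilt μ F α x ∂μ =
      1 + α ^ 2 * (μ.real (E ∩ F) - μ.real E * μ.real F) := by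
  have h (x : X) : tilt μ E α x * tilt μ F α x =
      (1 - α * μ.real F) * tilt μ E α x + α * F.indicator (tilt μ E α) x := by
    by_cases hx : x ∈ F <;> simp only [tilt, hx, Set.indicator_of_mem, Set.indicator_of_notMem,
      not_false_eq_true, Pi.one_apply] <;> ring
  have hint := integrable_tilt μ (α := α) hE
  simp_rw [h]
  rw [integral_add (hint.const_mul _) ((hint.indicator hF).const_mul α), integral_const_mul,
    integral_const_mul, integral_indicator hF, integral_tilt μ hE, setIntegral_tilt μ hE]
  ring

lemma integrable_exp_mul_indicator_mul_tilt (hE : MeasurableSet E) (r : ℝ) :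
    Integrable (fun x => Real.exp (-r * E.indicator 1 x) * tilt μ E α x) μ := by
  have hint := integrable_tilt μ (α := α) hE
  simp_rw [exp_mul_indicator_mul_tilt]
  exact hint.sub ((hint.indicator hE).const_mul _)

lemma integral_exp_mul_indicator_mul_tilt (hE : MeasurableSet E) (r : ℝ) :
    ∫ x, Real.exp (-r * E.indicator 1 x) * tilt μ E α x ∂μ =
      1 - μ.real E * (1 + α * (1 - μ.real E)) * (1 - Real.exp (-r)) := by
  have hint := integrable_tilt μ (α := α) hE
  simp_rw [exp_mul_indicator_mul_tilt]
  rw [integral_sub hint ((hint.indicator hE).const_mul _), integral_const_mul,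
    integral_indicator hE, integral_tilt μ hE, setIntegral_tilt μ hE, Set.inter_self]
  ring

end Tilt

section Likelihood

variable {ι X : Type*} [MeasurableSpace X] (μ : Measure X) {E F : Set X} {α : ℝ} (s : Finset ι)

/-- The density, with respect to the law of independent samples from `μ`, of the law under which
the samples with index in `s` are tilted towards the event `E` with strength `α`. -/
noncomputable def likelihood (E : Set X) (α : ℝ) (x : ι → X) : ℝ := ∏ i ∈ s, tilt μ E α (x i)

variable [IsProbabilityMeasure μ]

lemma integral_likelihood (hE : MeasurableSet E) :
    ∫ x, likelihood μ s E α x ∂Measure.infinitePi (fun _ : ι => μ) = 1 := by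
  unfold likelihood
  rw [integral_finset_prod_infinitePi s fun _ _ => (integrable_tilt μ hE).aestronglyMeasurable]
  simp only [integral_tilt μ hE, Finset.prod_const_one]

lemma memLp_likelihood (hE : MeasurableSet E) :
    MemLp (likelihood μ s E α) 2 (Measure.infinitePi fun _ : ι => μ) := by
  have hmeas := (integrable_finset_prod_infinitePi (ι := ι) s
    fun _ _ => integrable_tilt μ (α := α) hE).aestronglyMeasurable
  refine (memLp_two_iff_integrable_sq hmeas).2 ?_
  simp_rw [← Finset.prod_pow]
  exact integrable_finset_prod_infinitePi s fun _ _ => (memLp_tilt μ hE 2).integrable_sq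

lemma covariance_likelihood (hE : MeasurableSet E) (hF : MeasurableSet F) :
    cov[likelihood μ s E α, likelihood μ s F α; Measure.infinitePi fun _ : ι => μ] =
      (1 + α ^ 2 * (μ.real (E ∩ F) - μ.real E * μ.real F)) ^ s.card - 1 := by
  rw [covariance_eq_sub (memLp_likelihood μ s hE) (memLp_likelihood μ s hF),
    integral_likelihood μ s hE, integral_likelihood μ s hF, mul_one]
  simp only [Pi.mul_apply, likelihood, ← Finset.prod_mul_distrib]
  rw [integral_finset_prod_infinitePi (f := fun _ y => tilt μ E α y * tilt μ F α y) s fun _ _ =>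
    ((memLp_tilt μ hE 2).integrable_mul (memLp_tilt μ hF 2)).aestronglyMeasurable]
  simp only [integral_tilt_mul_tilt μ hE hF, Finset.prod_const]

lemma variance_likelihood_le (hE : MeasurableSet E) :
    Var[likelihood μ s E α; Measure.infinitePi fun _ : ι => μ] ≤
      Real.exp (s.card * (α ^ 2 * μ.real E)) := by
  have hE1 : μ.real E ≤ 1 := measureReal_le_one
  have hbase : 0 ≤ 1 + α ^ 2 * (μ.real E - μ.real E * μ.real E) := by
    have : 0 ≤ μ.real E * (1 - μ.real E) := mul_nonneg measureReal_nonneg (sub_nonneg.2 hE1)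
    nlinarith [sq_nonneg α]
  have hle : 1 + α ^ 2 * (μ.real E - μ.real E * μ.real E) ≤ Real.exp (α ^ 2 * μ.real E) := by
    nlinarith [Real.add_one_le_exp (α ^ 2 * μ.real E), sq_nonneg (α * μ.real E)]
  rw [← covariance_self (memLp_likelihood μ s hE).aemeasurable, covariance_likelihood μ s hE hE,
    Set.inter_self, Real.exp_nat_mul]
  linarith [pow_le_pow_left₀ hbase hle s.card]

lemma covariance_likelihood_nonpos (hE : MeasurableSet E) (hF : MeasurableSet F) (hα : 0 ≤ α)
    (hαE : α * μ.real E ≤ 1) (hαF : α * μ.real F ≤ 1)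
    (hneg : μ.real (E ∩ F) ≤ μ.real E * μ.real F) :
    cov[likelihood μ s E α, likelihood μ s F α; Measure.infinitePi fun _ : ι => μ] ≤ 0 := by
  have hprod : (α * μ.real E) * (α * μ.real F) ≤ 1 :=
    mul_le_one₀ hαE (mul_nonneg hα measureReal_nonneg) hαF
  have hinter : 0 ≤ α ^ 2 * μ.real (E ∩ F) := mul_nonneg (sq_nonneg α) measureReal_nonneg
  rw [covariance_likelihood μ s hE hF]
  refine sub_nonpos.2 (pow_le_one₀ (by linarith) ?_)
  nlinarith [sq_nonneg α]

lemma setIntegral_likelihood_le (hE : MeasurableSet E) (hα : 0 ≤ α) (hαE : α * μ.real E ≤ 1)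
    {r m : ℝ} (hr : 0 ≤ r) {B : Set (ι → X)} (hB : MeasurableSet B)
    (hm : ∀ x ∈ B, ∑ i ∈ s, E.indicator 1 (x i) ≤ m) :
    ∫ x in B, likelihood μ s E α x ∂Measure.infinitePi (fun _ => μ) ≤
      Real.exp (r * m -
        s.card * (μ.real E * (1 + α * (1 - μ.real E)) * (1 - Real.exp (-r)))) := by
  set q := μ.real E * (1 + α * (1 - μ.real E)) * (1 - Real.exp (-r))
  set g : X → ℝ := fun y => Real.exp (-r * E.indicator 1 y) * tilt μ E α y
  have hg_nonneg (y : X) : 0 ≤ g y := mul_nonneg (Real.exp_pos _).le (tilt_nonneg μ hα hαE y)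
  have hg_int : Integrable g μ := integrable_exp_mul_indicator_mul_tilt μ hE r
  have hg_integral : ∫ y, g y ∂μ = 1 - q := integral_exp_mul_indicator_mul_tilt μ hE r
  have hprod_int := (integrable_finset_prod_infinitePi s fun _ _ => hg_int).const_mul
    (Real.exp (r * m))
  have likelihood_le : ∀ x ∈ B, likelihood μ s E α x ≤ Real.exp (r * m) * ∏ i ∈ s, g (x i) := by
    intro x hx
    have hexp : 1 ≤ Real.exp (r * m + ∑ i ∈ s, -r * E.indicator 1 (x i)) := by
      rw [← Finset.mul_sum, Real.one_le_exp_iff]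
      nlinarith [hm x hx]
    rw [Finset.prod_mul_distrib, ← Real.exp_sum, ← mul_assoc, ← Real.exp_add]
    exact le_mul_of_one_le_left (Finset.prod_nonneg fun i _ => tilt_nonneg μ hα hαE (x i)) hexp
  calc ∫ x in B, likelihood μ s E α x ∂Measure.infinitePi (fun _ => μ)
      ≤ ∫ x in B, Real.exp (r * m) * ∏ i ∈ s, g (x i) ∂Measure.infinitePi (fun _ => μ) :=
        setIntegral_mono_on ((memLp_likelihood μ s hE).integrable one_le_two).integrableOn
          hprod_int.integrableOn hB likelihood_le
    _ ≤ ∫ x, Real.exp (r * m) * ∏ i ∈ s, g (x i) ∂Measure.infinitePi (fun _ => μ) :=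
        setIntegral_le_integral hprod_int <| ae_of_all _ fun x =>
          mul_nonneg (Real.exp_pos _).le (Finset.prod_nonneg fun i _ => hg_nonneg (x i))
    _ = Real.exp (r * m) * (1 - q) ^ s.card := by
        rw [integral_const_mul, integral_finset_prod_infinitePi s fun _ _ =>
          hg_int.aestronglyMeasurable]
        simp only [hg_integral, Finset.prod_const]
    _ ≤ Real.exp (r * m) * Real.exp (-q) ^ s.card := by
        have : 0 ≤ 1 - q := hg_integral ▸ integral_nonneg hg_nonneg
        gcongr
        exact Real.one_sub_le_exp_neg q
    _ = Real.exp (r * m - s.card * q) := by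
        rw [← Real.exp_nat_mul, ← Real.exp_add, mul_neg, sub_eq_add_neg]

end Likelihood

section Occupancy

variable {ι κ X : Type*} [Fintype κ] [MeasurableSpace X] (μ : Measure X)
  [IsProbabilityMeasure μ] {E : κ → Set X} {p α : ℝ}

lemma variance_average_likelihood_le (hE : ∀ k, MeasurableSet (E k))
    (hp : ∀ k, μ.real (E k) = p) (hneg : Pairwise fun k l => μ.real (E k ∩ E l) ≤ p ^ 2)
    (hα : 0 ≤ α) (hαp : α * p ≤ 1) (s : Finset ι) :
    Var[fun x => (Fintype.card κ : ℝ)⁻¹ * ∑ k, likelihood μ s (E k) α x;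
        Measure.infinitePi fun _ => μ] ≤
      (Fintype.card κ : ℝ)⁻¹ * Real.exp (s.card * (α ^ 2 * p)) := by
  classical
  have hcov (k l : κ) : cov[likelihood μ s (E k) α, likelihood μ s (E l) α;
      Measure.infinitePi fun _ => μ] ≤ if k = l then Real.exp (s.card * (α ^ 2 * p)) else 0 := by
    split_ifs with hkl
    · subst hkl
      rw [covariance_self (memLp_likelihood μ s (hE k)).aemeasurable, ← hp k]
      exact variance_likelihood_le μ s (hE k)
    · refine covariance_likelihood_nonpos μ s (hE k) (hE l) hα (by rwa [hp]) (by rwa [hp]) ?_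
      rw [hp, hp, ← sq]
      exact hneg hkl
  rw [variance_const_mul, variance_fun_sum fun k => memLp_likelihood μ s (hE k)]
  calc ((Fintype.card κ : ℝ)⁻¹) ^ 2 * ∑ k, ∑ l, cov[likelihood μ s (E k) α,
        likelihood μ s (E l) α; Measure.infinitePi fun _ => μ]
      ≤ ((Fintype.card κ : ℝ)⁻¹) ^ 2 *
          ∑ k : κ, ∑ l, if k = l then Real.exp (s.card * (α ^ 2 * p)) else 0 := by
        gcongr with k _ l _
        exact hcov k l
    _ = (Fintype.card κ : ℝ)⁻¹ * Real.exp (s.card * (α ^ 2 * p)) := by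
        obtain h | h := eq_or_ne (Fintype.card κ : ℝ) 0
        · simp [h]
        · simp only [inv_pow, Finset.sum_ite_eq, Finset.mem_univ, ↓reduceIte, Finset.sum_const,
            Finset.card_univ, nsmul_eq_mul]
          field_simp

theorem le_prob_exists_le_sum_indicator [Nonempty κ] (hE : ∀ k, MeasurableSet (E k))
    (hp : ∀ k, μ.real (E k) = p) (hneg : Pairwise fun k l => μ.real (E k ∩ E l) ≤ p ^ 2)
    (hα : 0 ≤ α) (hαp : α * p ≤ 1) (s : Finset ι) {r : ℝ} (hr : 0 ≤ r) (m : ℝ) :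
    1 - (Real.exp (r * m - s.card * (p * (1 + α * (1 - p)) * (1 - Real.exp (-r)))) +
        √((Fintype.card κ : ℝ)⁻¹ * Real.exp (s.card * (α ^ 2 * p)))) ≤
      (Measure.infinitePi fun _ => μ).real {x | ∃ k, m ≤ ∑ i ∈ s, (E k).indicator 1 (x i)} := by
  set P : Measure (ι → X) := Measure.infinitePi fun _ => μ
  set A : Set (ι → X) := {x | ∃ k, m ≤ ∑ i ∈ s, (E k).indicator 1 (x i)}
  set Z : (ι → X) → ℝ := fun x => (Fintype.card κ : ℝ)⁻¹ * ∑ k, likelihood μ s (E k) α x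
  have hLp (k : κ) : MemLp (likelihood μ s (E k) α) 2 P := memLp_likelihood μ s (hE k)
  have hL_int (k : κ) : Integrable (likelihood μ s (E k) α) P := (hLp k).integrable one_le_two
  have hZLp : MemLp Z 2 P := (memLp_finsetSum _ fun k _ => hLp k).const_mul _
  have hmean : P[Z] = 1 := by
    rw [integral_const_mul, integral_finsetSum _ fun k _ => hL_int k]
    simp [integral_likelihood μ s (hE _), P]
  have hA : MeasurableSet A := by
    have hcount (k : κ) : Measurable fun x : ι → X => ∑ i ∈ s, (E k).indicator (1 : X → ℝ) (x i) :=
      Finset.measurable_fun_sum _ fun i _ =>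
        (measurable_one.indicator (hE k)).comp (measurable_pi_apply i)
    exact measurableSet_setOfPred.2 (.exists fun k => measurableSet_setOfPred.1
      (measurableSet_le measurable_const (hcount k)))
  have hmixture : ∫ x in Aᶜ, Z x ∂P ≤
      Real.exp (r * m - s.card * (p * (1 + α * (1 - p)) * (1 - Real.exp (-r)))) := by
    rw [integral_const_mul, integral_finsetSum _ fun k _ => (hL_int k).integrableOn,
      inv_mul_le_iff₀ (by simp [Fintype.card_pos]), ← nsmul_eq_mul]
    refine Finset.sum_le_card_nsmul _ _ _ fun k _ => ?_
    rw [← hp k]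
    refine setIntegral_likelihood_le μ s (hE k) hα (by rwa [hp]) hr hA.compl fun x hx => ?_
    exact (not_le.1 (not_exists.1 hx k)).le
  have hvar := Real.sqrt_le_sqrt (variance_average_likelihood_le μ hE hp hneg hα hαp s)
  have := measureReal_le_setIntegral_add_sqrt_variance hZLp hmean Aᶜ
  rw [probReal_compl_eq_one_sub hA] at this
  linarith

end Occupancy

section ReceivedBalls

/-- The law of the decision of a single generator in a single round: whether it generates a ball,
and the bin to which that ball is assigned. -/
noncomputable abbrev ballLaw (n : ℕ) (lam : unitInterval) : Measure (Bool × Fin n) :=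
  (bernoulliMeasure true false lam).prod (uniformOn (Set.univ : Set (Fin n)))

instance isProbabilityMeasure_ballLaw (n : ℕ) [NeZero n] (lam : unitInterval) :
    IsProbabilityMeasure (ballLaw n lam) := by
  have : IsProbabilityMeasure (uniformOn (Set.univ : Set (Fin n))) :=
    isProbabilityMeasure_uniformOn Set.finite_univ Set.univ_nonempty
  infer_instance

instance isProbabilityMeasure_law (n : ℕ) [NeZero n] (lam : unitInterval) :
    IsProbabilityMeasure (law n lam) :=
  inferInstanceAs (IsProbabilityMeasure (Measure.infinitePi fun _ => ballLaw n lam))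

variable {n : ℕ}

lemma ballLaw_real_singleton_true (lam : unitInterval) (i : Fin n) :
    (ballLaw n lam).real {(true, i)} = lam / n := by
  rw [← Set.singleton_prod_singleton, measureReal_prod_prod,
    bernoulliMeasure_real_apply_of_mem_of_notMem _ (by measurability) (by simp) (by simp)]
  simp [measureReal_def, uniformOn_univ, div_eq_mul_inv]

lemma sum_indicator_eq_sum_received (ω : Outcome n) (t : ℕ) (i : Fin n) :
    ∑ a ∈ Finset.range t ×ˢ Finset.univ, Set.indicator {(true, i)} (1 : Bool × Fin n → ℝ) (ω a) =
      ∑ u ∈ Finset.range t, (received ω u i : ℝ) := by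
  rw [Finset.sum_product]
  simp [received, Set.indicator_apply]

lemma sum_received_le_load_add (ω : Outcome n) (t : ℕ) (i : Fin n) :
    ∑ u ∈ Finset.range t, received ω u i ≤ load ω t i + t := by
  induction t with
  | zero => simp
  | succ t ih =>
    simp only [Finset.sum_range_succ, load]
    omega

lemma le_prob_exists_le_load [NeZero n] (lam : unitInterval) {α r : ℝ} (hα : 0 ≤ α)
    (hαn : α * (lam / n) ≤ 1) (hr : 0 ≤ r) (m : ℝ) (t : ℕ) :
    1 - (Real.exp (r * (m + t) - t * (lam * (1 + α * (1 - lam / n)) * (1 - Real.exp (-r)))) +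
        √((n : ℝ)⁻¹ * Real.exp (t * (α ^ 2 * lam)))) ≤
      (law n lam).real {ω | ∃ i, m ≤ (load ω t i : ℝ)} := by
  have hdisj : Pairwise fun i j : Fin n =>
      (ballLaw n lam).real ({(true, i)} ∩ {(true, j)}) ≤ ((lam : ℝ) / n) ^ 2 := by
    intro i j hij
    have : ({(true, i)} ∩ {(true, j)} : Set (Bool × Fin n)) = ∅ :=
      Set.singleton_inter_eq_empty.2 (by simp [hij])
    simp only [this, measureReal_empty]
    positivity
  have h := le_prob_exists_le_sum_indicator (ballLaw n lam)
    (fun _ => measurableSet_singleton _) (ballLaw_real_singleton_true lam) hdisj hα hαn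
    (Finset.range t ×ˢ (Finset.univ : Finset (Fin n))) hr (m + t)
  have hn : (n : ℝ) ≠ 0 := NeZero.ne _
  have hmean : ((t * n : ℕ) : ℝ) * (lam / n * (1 + α * (1 - lam / n)) * (1 - Real.exp (-r))) =
      t * (lam * (1 + α * (1 - lam / n)) * (1 - Real.exp (-r))) := by
    push_cast
    field_simp
  have hvar : ((t * n : ℕ) : ℝ) * (α ^ 2 * (lam / n)) = t * (α ^ 2 * lam) := by
    push_cast
    field_simp
  simp only [Finset.card_product, Finset.card_range, Finset.card_univ, Fintype.card_fin, hmean,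
    hvar, sum_indicator_eq_sum_received] at h
  refine h.trans (measureReal_mono ?_)
  rintro ω ⟨i, hi⟩
  refine ⟨i, le_of_add_le_add_right (hi.trans ?_)⟩
  exact_mod_cast sum_received_le_load_add ω t i

end ReceivedBalls

section CriticalTime

variable {n t : ℕ} {l : ℝ}

lemma criticalTime_mul_sq (n : ℕ) (hl : l < 1) :
    criticalTime n l * (1 - l) ^ 2 = 9 * l * Real.log n / 64 := by
  have : 1 - l ≠ 0 := (sub_pos.2 hl).ne'
  unfold criticalTime
  field_simp

lemma le_mul_sq_of_near_criticalTime (hn : 32 ≤ Real.log n) (hl : 1 / 2 ≤ l) (hl1 : l < 1)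
    (ht : |(t : ℝ) - criticalTime n l| < 1) : Real.log n / 16 ≤ t * (1 - l) ^ 2 := by
  have := (abs_lt.1 ht).1
  nlinarith [criticalTime_mul_sq n hl1]

lemma mul_sq_le_of_near_criticalTime (hl1 : l < 1) (ht : |(t : ℝ) - criticalTime n l| < 1) :
    t * (1 - l) ^ 2 ≤ 9 * l * Real.log n / 64 + (1 - l) ^ 2 := by
  have := (abs_lt.1 ht).2
  nlinarith [criticalTime_mul_sq n hl1, sq_nonneg (1 - l)]

lemma chernoff_exponent_le (hn : 4 ≤ n) (hl : 1 / 2 ≤ l) (hl1 : l < 1)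
    (ht : Real.log n / 16 ≤ t * (1 - l) ^ 2) :
    (1 - l) / 4 * (1 / 128 * (1 / (1 - l) * Real.log n) + t) -
        t * (l * (1 + 2 * (1 - l) / l * (1 - l / n)) * (1 - Real.exp (-((1 - l) / 4)))) ≤
      -(Real.log n / 1024) := by
  obtain ⟨d, rfl⟩ : ∃ d, l = 1 - d := ⟨1 - l, by ring⟩
  rw [sub_sub_cancel] at ht ⊢
  have hd : 0 < d := by linarith
  have hn' : (4 : ℝ) ≤ n := by exact_mod_cast hn
  have tilted_rate_ge : 1 + d / 2 ≤ (1 - d) * (1 + 2 * d / (1 - d) * (1 - (1 - d) / n)) := by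
    have hdiv : (1 - d) / n ≤ 1 / 4 := by
      rw [div_le_iff₀ (by linarith)]
      linarith
    have : (1 - d) * (1 + 2 * d / (1 - d) * (1 - (1 - d) / n)) =
        1 - d + 2 * d * (1 - (1 - d) / n) := by
      have : 1 - d ≠ 0 := by linarith
      field_simp
    nlinarith
  have one_sub_exp_ge : d / 4 - (d / 4) ^ 2 ≤ 1 - Real.exp (-(d / 4)) := by
    have h := Real.abs_exp_sub_one_sub_id_le (x := -(d / 4)) (by
      rw [abs_neg, abs_of_pos] <;> linarith)
    linarith [(abs_le.1 h).2]
  calc d / 4 * (1 / 128 * (1 / d * Real.log n) + t) -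
        t * ((1 - d) * (1 + 2 * d / (1 - d) * (1 - (1 - d) / n)) * (1 - Real.exp (-(d / 4))))
      ≤ d / 4 * (1 / 128 * (1 / d * Real.log n) + t) -
          t * ((1 + d / 2) * (d / 4 - (d / 4) ^ 2)) := by
        gcongr
        · nlinarith
        · linarith
    _ = Real.log n / 512 - t * d ^ 2 * (1 / 16 - d / 32) := by
        field_simp
        ring
    _ ≤ Real.log n / 512 - Real.log n / 16 * (3 / 64) := by
        gcongr
        linarith
    _ = -(Real.log n / 1024) := by ring

lemma variance_exponent_le (hn : 32 ≤ Real.log n) (hl : 1 / 2 ≤ l) (hl1 : l < 1)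
    (ht : |(t : ℝ) - criticalTime n l| < 1) :
    t * ((2 * (1 - l) / l) ^ 2 * l) - Real.log n ≤ -(Real.log n / 512) := by
  have h := mul_sq_le_of_near_criticalTime hl1 ht
  have hl0 : 0 < l := by linarith
  calc t * ((2 * (1 - l) / l) ^ 2 * l) - Real.log n
      = 4 * (t * (1 - l) ^ 2) / l - Real.log n := by
        field_simp
        ring
    _ ≤ (9 / 16 * Real.log n + 2) - Real.log n := by
        gcongr
        rw [div_le_iff₀ hl0]
        nlinarith
    _ ≤ -(Real.log n / 512) := by linarith

end CriticalTime

section LowerBound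

variable {n t : ℕ} {lam : unitInterval}

lemma natCast_rpow_eq_exp (hn : 1 ≤ n) :
    (n : ℝ) ^ (-(1 / 1024) : ℝ) = Real.exp (-(Real.log n / 1024)) := by
  rw [Real.rpow_def_of_pos (by exact_mod_cast hn)]
  ring_nf

theorem one_sub_rpow_le_prob_exists_le_load (hn : 1 ≤ n) (hlam : (1 / 2 : ℝ) ≤ lam)
    (hlam1 : (lam : ℝ) < 1) (ht : |(t : ℝ) - criticalTime n lam| < 1) :
    1 - 2 * (n : ℝ) ^ (-(1 / 1024) : ℝ) ≤ (law n lam).real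
      {ω | ∃ i, 1 / 128 * (1 / (1 - (lam : ℝ)) * Real.log n) ≤ (load ω t i : ℝ)} := by
  have : NeZero n := ⟨by omega⟩
  have hn0 : (0 : ℝ) < n := by exact_mod_cast hn
  rw [natCast_rpow_eq_exp hn]
  obtain hlog | hlog := lt_or_ge (Real.log n) 32
  · have : 1 / 2 ≤ Real.exp (-(Real.log n / 1024)) := by
      linarith [Real.add_one_le_exp (-(Real.log n / 1024))]
    exact le_trans (by linarith) measureReal_nonneg
  have hn4 : 4 ≤ n := by
    have : (4 : ℝ) ≤ n := by linarith [Real.log_le_sub_one_of_pos hn0]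
    exact_mod_cast this
  have hstrength : 2 * (1 - (lam : ℝ)) / lam * (lam / n) ≤ 1 := by
    have hn4' : (4 : ℝ) ≤ n := by exact_mod_cast hn4
    rw [div_mul_div_cancel₀ (by linarith), div_le_one hn0]
    linarith
  have chernoff_le := Real.exp_le_exp.2 <|
    chernoff_exponent_le hn4 hlam hlam1 (le_mul_sq_of_near_criticalTime hlog hlam hlam1 ht)
  have sqrt_variance_le : √((n : ℝ)⁻¹ * Real.exp (t * ((2 * (1 - (lam : ℝ)) / lam) ^ 2 * lam))) ≤
      Real.exp (-(Real.log n / 1024)) := by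
    refine Real.sqrt_le_iff.2 ⟨(Real.exp_pos _).le, ?_⟩
    rw [← Real.exp_log (inv_pos.2 hn0), ← Real.exp_add, ← Real.exp_nat_mul, Real.exp_le_exp,
      Real.log_inv]
    push_cast
    linarith [variance_exponent_le hlog hlam hlam1 ht]
  -- This `α` raises the rate of the favoured bin from `lam` to about `2 - lam`, so that it receives
  -- `(1 - lam) * t` balls more than it deletes.
  have h := le_prob_exists_le_load lam (α := 2 * (1 - lam) / lam) (r := (1 - lam) / 4)
    (div_nonneg (by linarith) (by linarith)) hstrength (by linarith)
    (1 / 128 * (1 / (1 - (lam : ℝ)) * Real.log n)) t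
  linarith

lemma exists_eval_le_pow (p : Polynomial ℝ) : ∃ k : ℕ, ∀ x : ℝ, 2 ≤ x → p.eval x ≤ x ^ k := by
  obtain ⟨j, hj⟩ := pow_unbounded_of_one_lt
    (∑ i ∈ Finset.range (p.natDegree + 1), |p.coeff i|) one_lt_two
  refine ⟨j + p.natDegree, fun x hx => ?_⟩
  have hx1 : 1 ≤ x := one_le_two.trans hx
  calc p.eval x = ∑ i ∈ Finset.range (p.natDegree + 1), p.coeff i * x ^ i :=
        Polynomial.eval_eq_sum_range x
    _ ≤ ∑ i ∈ Finset.range (p.natDegree + 1), |p.coeff i| * x ^ p.natDegree := by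
        gcongr with i hi
        · exact le_abs_self _
        · exact Nat.le_of_lt_succ (Finset.mem_range.1 hi)
    _ = (∑ i ∈ Finset.range (p.natDegree + 1), |p.coeff i|) * x ^ p.natDegree :=
        (Finset.sum_mul _ _ _).symm
    _ ≤ x ^ j * x ^ p.natDegree := by
        gcongr
        exact hj.le.trans (by gcongr)
    _ = x ^ (j + p.natDegree) := (pow_add x j _).symm

lemma log_div_le_of_inv_le_pow {x y : ℝ} {k : ℕ} (hx : 0 < x) (hy : 0 < y) (hxy : x⁻¹ ≤ y ^ k) :
    Real.log (y / x) ≤ (k + 1) * Real.log y := by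
  rw [Real.log_div hy.ne' hx.ne', sub_eq_add_neg, ← Real.log_inv, add_mul, one_mul, add_comm,
    ← Real.log_pow]
  gcongr

theorem one_sub_rpow_le_prob_exists_le_load_of_inv_le_pow {k : ℕ} (hn : 1 ≤ n)
    (hlam : (1 / 2 : ℝ) ≤ lam) (hlam1 : (lam : ℝ) < 1) (hpow : (1 - (lam : ℝ))⁻¹ ≤ (n : ℝ) ^ k)
    (ht : |(t : ℝ) - criticalTime n lam| < 1) :
    1 - 2 * (n : ℝ) ^ (-(1 / 1024) : ℝ) ≤ (law n lam).real
      {ω | ∃ i, 1 / (128 * (k + 1)) * (1 / (1 - (lam : ℝ)) * Real.log (n / (1 - (lam : ℝ)))) ≤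
        (load ω t i : ℝ)} := by
  have : NeZero n := ⟨by omega⟩
  have hd : 0 < 1 - (lam : ℝ) := sub_pos.2 hlam1
  have threshold_le :
      1 / (128 * ((k : ℝ) + 1)) * (1 / (1 - (lam : ℝ)) * Real.log (n / (1 - (lam : ℝ)))) ≤
        1 / 128 * (1 / (1 - (lam : ℝ)) * Real.log n) :=
    calc _ ≤ 1 / (128 * ((k : ℝ) + 1)) * (1 / (1 - (lam : ℝ)) * ((k + 1) * Real.log n)) := by
          gcongr
          exact log_div_le_of_inv_le_pow hd (by exact_mod_cast hn) hpow
      _ = 1 / 128 * (1 / (1 - (lam : ℝ)) * Real.log n) := by field_simp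
  refine (one_sub_rpow_le_prob_exists_le_load hn hlam hlam1 ht).trans (measureReal_mono ?_)
  rintro ω ⟨i, hi⟩
  exact ⟨i, threshold_le.trans hi⟩

lemma tendsto_two_mul_natCast_rpow :
    Tendsto (fun n : ℕ => 2 * (n : ℝ) ^ (-(1 / 1024) : ℝ)) atTop (𝓝 0) := by
  have h := (tendsto_rpow_neg_atTop (by norm_num : (0 : ℝ) < 1 / 1024)).comp
    tendsto_natCast_atTop_atTop
  simpa using h.const_mul 2

end LowerBound

end OneChoice

theorem mainTheorem6 :
    (∃ c : ℝ, 0 < c ∧ ∃ ε : ℕ → ℝ, Tendsto ε atTop (𝓝 0) ∧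
      ∀ (n : ℕ) (lam : unitInterval) (t : ℕ), 1 ≤ n →
        (1 / 2 : ℝ) ≤ (lam : ℝ) → (lam : ℝ) < 1 →
        |(t : ℝ) - OneChoice.criticalTime n lam| < 1 →
          1 - ε n ≤ (OneChoice.law n lam).real
            {ω | ∃ i : Fin n,
              c * (1 / (1 - (lam : ℝ)) * Real.log n) ≤ (OneChoice.load ω t i : ℝ)}) ∧
    (∀ p : Polynomial ℝ,
      ∃ c : ℝ, 0 < c ∧ ∃ ε : ℕ → ℝ, Tendsto ε atTop (𝓝 0) ∧
      ∀ (n : ℕ) (lam : unitInterval) (t : ℕ), 1 ≤ n →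
        0 < p.eval (n : ℝ) →
        (1 / 2 : ℝ) ≤ (lam : ℝ) → (lam : ℝ) ≤ 1 - 1 / p.eval (n : ℝ) →
        |(t : ℝ) - OneChoice.criticalTime n lam| < 1 →
          1 - ε n ≤ (OneChoice.law n lam).real
            {ω | ∃ i : Fin n,
              c * (1 / (1 - (lam : ℝ)) * Real.log (n / (1 - (lam : ℝ)))) ≤
                (OneChoice.load ω t i : ℝ)}) := by
  refine ⟨⟨1 / 128, by norm_num, _, OneChoice.tendsto_two_mul_natCast_rpow,
    fun n lam t hn hlam hlam1 ht =>
      OneChoice.one_sub_rpow_le_prob_exists_le_load hn hlam hlam1 ht⟩, fun p => ?_⟩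
  obtain ⟨k, hk⟩ := OneChoice.exists_eval_le_pow p
  refine ⟨1 / (128 * (k + 1)), by positivity, _, OneChoice.tendsto_two_mul_natCast_rpow,
    fun n lam t hn hp hlam hlamp ht => ?_⟩
  obtain rfl | hn2 := hn.eq_or_lt
  · exact le_trans (by norm_num) measureReal_nonneg
  have hinv : 1 / p.eval (n : ℝ) ≤ 1 - lam := by linarith
  have hd : 0 < 1 - (lam : ℝ) := (one_div_pos.2 hp).trans_le hinv
  refine OneChoice.one_sub_rpow_le_prob_exists_le_load_of_inv_le_pow hn hlam (by linarith) ?_ ht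
  calc (1 - (lam : ℝ))⁻¹ ≤ p.eval (n : ℝ) := by rwa [inv_le_comm₀ hd hp, ← one_div]
    _ ≤ (n : ℝ) ^ k := hk n (by exact_mod_cast hn2)
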